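/- Let $q_0,q_1,q_2$ be the vertices of an equilateral triangle in the plane, $F_i(x)=\tfrac12(x+q_i)$, let $SG$ be the Sierpinski gasket (the nonempty compact set with $SG=\bigcup_{i}F_i(SG)$), and $V_0=\{q_0,q_1,q_2\}$. For continuous $u,v:SG\to\mathbb R$ let $$\mathcal E_m(u,v)=\left(\tfrac53\right)^m\sum_{|w|=m}\ \sum_{0\le i<j\le 2}\bigl(u(F_wq_i)-u(F_wq_j)\bigr)\bigl(v(F_wq_i)-v(F_wq_j)\bigr),\qquad \mathcal E(u,v)=\lim_{m\to\infty}\mathcal E_m(u,v),$$ and let $\operatorname{dom}\mathcal E$ be the set of continuous $u$ with $\mathcal E(u,u)=\sup_m\mathcal E_m(u,u)<\infty$. A continuous function is harmonic if for every $m$ it minimizes $\mathcal E_m(\cdot,\cdot)$ (on the diagonal) among the continuous functions with the same values on $V_0$; let $h_j$ be the harmonic function with $h_j(q_i)=\delta_{ij}$. Let $\zeta$ be a finite Borel measure on $SG$ that is positive (every nonempty open subset of $SG$, equivalently every cell $F_w(SG)$, has positive measure) and continuous (points have measure $0$). Let $\operatorname{dom}_{L^2}\Delta_\zeta$ be the set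 of $u\in\operatorname{dom}\mathcal E$ for which there is $f\in L^2(\zeta)$ with $\mathcal E(u,v)=-\int f v\,d\zeta$ for all $v\in\operatorname{dom}\mathcal E$ with $v|_{V_0}=0$; this $f$ is unique and is denoted $\Delta_\zeta u$. **Theorem.** Let $E\subset SG$ be a finite set that contains three points $x_1,x_2,x_3$ for which the $3\times 3$ matrix $\bigl(h_j(x_k)\bigr)_{k,j}$ is invertible, and let real numbers $a_x$, $x\in E$, be given. Set $$Y=\{u\in\operatorname{dom}_{L^2}\Delta_\zeta : u(x)=a_x\ \text{for all } x\in E\}.$$ Then there is exactly one $u\in Y$ that minimizes $$T_\zeta(u)=\int_{SG}|\Delta_\zeta u|^2\,d\zeta$$ over $Y$. -/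

import Mathlib

open MeasureTheory Filter Topology

noncomputable section

namespace SierpinskiGasket

/-- The Euclidean plane. -/
abbrev Plane : Type := EuclideanSpace ℝ (Fin 2)

/-- The vertices of an equilateral triangle of side 1. -/
def vertex : Fin 3 → Plane :=
  ![!₂[0, 0], !₂[1, 0], !₂[1 / 2, Real.sqrt 3 / 2]]

/-- The contraction of the plane with ratio `1 / 2` and fixed point `vertex i`. -/
def contraction (i : Fin 3) (x : Plane) : Plane :=
  vertex i + (1 / 2 : ℝ) • (x - vertex i)

/-- The vertices of level `m`: `V 0` is the set of the three corners and
`V (m + 1)` is the union of the three images of `V m`. -/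
def V : ℕ → Set Plane
  | 0 => Set.range vertex
  | m + 1 => ⋃ i : Fin 3, contraction i '' V m

/-- The Sierpinski gasket, as the closure of the set of all its vertices. -/
def SG : Set Plane := closure (⋃ m, V m)

theorem vertex_mem_SG (i : Fin 3) : vertex i ∈ SG :=
  subset_closure (Set.mem_iUnion.2 ⟨0, i, rfl⟩)

theorem continuous_contraction (i : Fin 3) : Continuous (contraction i) := by
  unfold contraction
  fun_prop

theorem contraction_mem_SG (i : Fin 3) {x : Plane} (hx : x ∈ SG) :
    contraction i x ∈ SG := by
  have h : Set.MapsTo (contraction i) (⋃ m, V m) (⋃ m, V m) := by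
    intro y hy
    obtain ⟨m, hm⟩ := Set.mem_iUnion.1 hy
    exact Set.mem_iUnion.2 ⟨m + 1, Set.mem_iUnion.2 ⟨i, y, hm, rfl⟩⟩
  exact h.closure (continuous_contraction i) hx

/-- The boundary points `q 0, q 1, q 2` of the gasket. -/
def q (i : Fin 3) : SG := ⟨vertex i, vertex_mem_SG i⟩

/-- The maps `F 0, F 1, F 2` of the gasket into itself. -/
def F (i : Fin 3) (x : SG) : SG := ⟨contraction i x, contraction_mem_SG i x.2⟩

/-- `Fw [i₁, …, iₘ]` is the composition `F i₁ ∘ ⋯ ∘ F iₘ`. -/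
def Fw : List (Fin 3) → SG → SG
  | [] => id
  | i :: w => F i ∘ Fw w

/-- The renormalized graph energy form of level `m`,
`(5 / 3) ^ m * ∑ (u x - u y) * (v x - v y)`, the sum being over the edges of the `m`-th graph.
Every edge joins two corners of exactly one cell `F_w (SG)` with `|w| = m`. -/
def graphEnergy (m : ℕ) (u v : C(SG, ℝ)) : ℝ :=
  (5 / 3 : ℝ) ^ m * ∑ w : Fin m → Fin 3, ∑ i : Fin 3, ∑ j ∈ Finset.Ioi i,
    (u (Fw (List.ofFn w) (q i)) - u (Fw (List.ofFn w) (q j))) *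
      (v (Fw (List.ofFn w) (q i)) - v (Fw (List.ofFn w) (q j)))

/-- The functions of finite energy: `graphEnergy m u u` is nondecreasing in `m`, and its
limit is finite. -/
def domEnergy : Set C(SG, ℝ) :=
  {u | BddAbove (Set.range fun m : ℕ => graphEnergy m u u)}

/-- The functions of finite energy that vanish on the boundary. -/
def domEnergyZero : Set C(SG, ℝ) :=
  {u | u ∈ domEnergy ∧ ∀ i, u (q i) = 0}

/-- `f` is a version of the Laplacian `Δ_ζ u` in `L²(ζ)`: `u` has finite energy and
`ℰ(u, v) = - ∫ f v dζ` for all `v` of finite energy that vanish on the boundary, where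
`ℰ(u, v)` is the limit of the graph energies. -/
def IsLaplacian (ζ : Measure SG) (u : C(SG, ℝ)) (f : Lp ℝ 2 ζ) : Prop :=
  u ∈ domEnergy ∧ ∀ v ∈ domEnergyZero,
    Tendsto (fun m => graphEnergy m u v) atTop (𝓝 (-∫ x, f x * v x ∂ζ))

/-- The `L²`-domain of the Laplacian `Δ_ζ`. -/
def domLaplacian (ζ : Measure SG) : Set C(SG, ℝ) :=
  {u | ∃ f : Lp ℝ 2 ζ, IsLaplacian ζ u f}

open Classical in
/-- The Laplacian `Δ_ζ u`, an element of `L²(ζ)`, for `u` in the `L²`-domain (and `0` for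
other `u`). It is unique when `ζ` is finite and has no atoms. -/
def laplacian (ζ : Measure SG) (u : C(SG, ℝ)) : Lp ℝ 2 ζ :=
  if h : ∃ f : Lp ℝ 2 ζ, IsLaplacian ζ u f then h.choose else 0

/-- The functional `T_ζ(u) = ∫ |Δ_ζ u|² dζ`. -/
def T (ζ : Measure SG) (u : C(SG, ℝ)) : ℝ :=
  ∫ x, |laplacian ζ u x| ^ 2 ∂ζ

/-- A function is harmonic if, for every level, it minimizes the graph energy among all
functions with the same boundary values. -/
def IsHarmonic (u : C(SG, ℝ)) : Prop :=
  ∀ (m : ℕ) (v : C(SG, ℝ)), (∀ i, v (q i) = u (q i)) →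
    graphEnergy m u u ≤ graphEnergy m v v

/-- `h j` is the harmonic function with boundary values `h j (q i) = δ_ij`
(there is exactly one). -/
def h (j : Fin 3) : C(SG, ℝ) :=
  Classical.epsilon fun u => IsHarmonic u ∧ ∀ i, u (q i) = if i = j then 1 else 0

/-- The set `Y` of all `u` in the `L²`-domain of `Δ_ζ` with `u x = a x` for `x ∈ E`. -/
def constraintSet (ζ : Measure SG) (E : Finset SG) (a : E → ℝ) : Set C(SG, ℝ) :=
  {u | u ∈ domLaplacian ζ ∧ ∀ x : E, u x = a x}

end SierpinskiGasket

end

noncomputable section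

namespace SierpinskiGasket

/-! A function in the Laplacian domain is determined by its boundary values `c` and its Laplacian
`f`: it is `harmonicFun c + toContinuousMap (green ζ f)`, and every pair `(c, f)` occurs
(`isLaplacian_iff`, `isLaplacian_harmonic_add_green`). In these coordinates the functional is `‖f‖ ^
2` and the constraint is a linear equation `A c + B f = a` in the finite-dimensional space `E → ℝ`.
The admissible `f` thus form a translate of the closed subspace `W = B⁻¹(range A)`, which has
exactly one element of least norm once it is nonempty. The matrix hypothesis makes `A` injective, so
that `f` determines `c`.

Nonemptiness (`exists_interpolation`) is a duality argument. It needs two facts about the energy: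
finite energy controls oscillation, so that the functions of finite energy vanishing on the boundary
form a Hilbert space embedded continuously in `C(SG, ℝ)` and `green` is minus an adjoint; and these
functions are uniformly dense among the continuous functions vanishing on the boundary, by gluing
harmonic pieces. Absence of atoms makes the Laplacian unique; positivity of the measure on open sets
makes the range of `green` dense. -/

/-! ### Geometry of the gasket -/

/-- The barycentric coordinates of a point of the plane with respect to the three vertices. -/
def bary (x : Plane) : Fin 3 → ℝ :=
  ![1 - x 0 - x 1 / Real.sqrt 3, x 0 - x 1 / Real.sqrt 3, 2 * x 1 / Real.sqrt 3]

theorem continuous_bary (k : Fin 3) : Continuous fun x => bary x k := by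
  fin_cases k <;> simp [bary] <;> fun_prop

theorem sum_bary (x : Plane) : bary x 0 + bary x 1 + bary x 2 = 1 := by
  simp [bary]; ring

theorem bary_vertex (i k : Fin 3) : bary (vertex i) k = if i = k then 1 else 0 := by
  have h3 : Real.sqrt 3 ≠ 0 := by positivity
  fin_cases i <;> fin_cases k <;> simp [bary, vertex] <;> field_simp <;> norm_num

theorem bary_contraction (i : Fin 3) (x : Plane) (k : Fin 3) :
    bary (contraction i x) k = (bary x k + bary (vertex i) k) / 2 := by
  fin_cases k <;> simp [bary, contraction] <;> ring

theorem bary_injective : Function.Injective bary := by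
  intro x y hxy
  have h3 : Real.sqrt 3 ≠ 0 := by positivity
  have h1 := congrFun hxy 1
  have h2 := congrFun hxy 2
  simp only [bary, Matrix.cons_val_one, Matrix.cons_val_zero, Matrix.cons_val] at h1 h2
  have e1 : x 1 = y 1 := by
    field_simp at h2
    linarith
  rw [e1] at h1
  ext k
  fin_cases k
  · simpa using h1
  · exact e1

theorem contraction_eq (i : Fin 3) (x : Plane) :
    contraction i x = (1 / 2 : ℝ) • (x + vertex i) := by
  unfold contraction
  module

theorem bary_nonneg {x : Plane} (hx : x ∈ SG) (k : Fin 3) : 0 ≤ bary x k := by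
  have hV : ∀ m, ∀ x ∈ V m, ∀ k, 0 ≤ bary x k := by
    intro m
    induction m with
    | zero =>
      rintro _ ⟨i, rfl⟩ k
      rw [bary_vertex]
      split_ifs <;> norm_num
    | succ m ih =>
      intro x hx k
      obtain ⟨i, y, hy, rfl⟩ := Set.mem_iUnion.1 hx
      rw [bary_contraction, bary_vertex]
      have := ih y hy k
      split_ifs <;> linarith
  have hcl : IsClosed {x : Plane | 0 ≤ bary x k} :=
    isClosed_le continuous_const (continuous_bary k)
  refine closure_minimal ?_ hcl hx
  intro y hy
  obtain ⟨m, hm⟩ := Set.mem_iUnion.1 hy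
  exact hV m y hm k

theorem norm_vertex_le (i : Fin 3) : ‖vertex i‖ ≤ 1 := by
  rw [EuclideanSpace.norm_eq]
  have : (Real.sqrt 3) ^ 2 = 3 := Real.sq_sqrt (by norm_num)
  fin_cases i <;> simp [vertex, Fin.sum_univ_two, div_pow, this]
  norm_num

theorem norm_le_of_mem_SG {x : Plane} (hx : x ∈ SG) : ‖x‖ ≤ 1 := by
  have hV : ∀ m, ∀ x ∈ V m, ‖x‖ ≤ 1 := by
    intro m
    induction m with
    | zero =>
      rintro _ ⟨i, rfl⟩
      exact norm_vertex_le i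
    | succ m ih =>
      intro x hx
      obtain ⟨i, y, hy, rfl⟩ := Set.mem_iUnion.1 hx
      rw [contraction_eq, norm_smul]
      have h1 := norm_add_le y (vertex i)
      have h2 := ih y hy
      have h3 := norm_vertex_le i
      norm_num
      linarith
  have hcl : IsClosed {x : Plane | ‖x‖ ≤ 1} := isClosed_le continuous_norm continuous_const
  refine closure_minimal ?_ hcl hx
  intro y hy
  obtain ⟨m, hm⟩ := Set.mem_iUnion.1 hy
  exact hV m y hm

theorem isCompact_SG : IsCompact SG :=
  Metric.isCompact_of_isClosed_isBounded isClosed_closure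
    (isBounded_iff_forall_norm_le.2 ⟨1, fun _ hx => norm_le_of_mem_SG hx⟩)

instance : CompactSpace SG := isCompact_iff_compactSpace.1 isCompact_SG

theorem dist_le_two (x y : SG) : dist x y ≤ 2 := by
  have h1 := norm_le_of_mem_SG x.2
  have h2 := norm_le_of_mem_SG y.2
  have h3 := norm_sub_le (x : Plane) y
  rw [Subtype.dist_eq, dist_eq_norm]
  linarith

theorem continuous_F (i : Fin 3) : Continuous (F i) :=
  ((continuous_contraction i).comp continuous_subtype_val).subtype_mk _

theorem F_q_self (i : Fin 3) : F i (q i) = q i := by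
  apply Subtype.ext
  simp [F, q, contraction]

theorem F_q_comm (i j : Fin 3) : F i (q j) = F j (q i) := by
  apply Subtype.ext
  simp only [F, q, contraction_eq]
  rw [add_comm]

theorem F_injective (i : Fin 3) : Function.Injective (F i) := by
  intro x y hxy
  have := congrArg Subtype.val hxy
  simp only [F, contraction_eq] at this
  have := smul_right_injective Plane (by norm_num : (1 / 2 : ℝ) ≠ 0) this
  exact Subtype.ext (add_right_cancel this)

theorem dist_F (i : Fin 3) (x y : SG) : dist (F i x) (F i y) = dist x y / 2 := by
  rw [Subtype.dist_eq, Subtype.dist_eq]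
  simp only [F, contraction_eq]
  rw [dist_smul₀, dist_add_right]
  norm_num
  ring

theorem eq_q_of_bary {x : SG} {i : Fin 3} (hx : 1 ≤ bary x i) : x = q i := by
  apply Subtype.ext
  apply bary_injective
  have h0 := bary_nonneg x.2 0
  have h1 := bary_nonneg x.2 1
  have h2 := bary_nonneg x.2 2
  have hs := sum_bary x
  ext k
  simp only [q, bary_vertex]
  fin_cases i <;> fin_cases k <;> simp at hx ⊢ <;> linarith

/-- Comparing `j`-th barycentric coordinates gives `bary x j = bary y j + 1 ≥ 1`. Hence distinct
cells of level one meet only at junction points. -/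
theorem eq_q_of_F_eq_F {i j : Fin 3} (hij : i ≠ j) {x y : SG} (hxy : F i x = F j y) :
    x = q j := by
  apply eq_q_of_bary
  have := congrArg (fun z : SG => bary z j) hxy
  simp only [F, bary_contraction, bary_vertex, if_neg hij, if_true] at this
  have := bary_nonneg y.2 j
  linarith

theorem exists_F_eq (x : SG) : ∃ i y, F i y = x := by
  have hcl : IsClosed (⋃ i, contraction i '' SG) :=
    isClosed_iUnion_of_finite fun i =>
      (isCompact_SG.image (continuous_contraction i)).isClosed
  have hsub : SG ⊆ ⋃ i, contraction i '' SG := by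
    refine closure_minimal ?_ hcl
    intro y hy
    obtain ⟨m, hm⟩ := Set.mem_iUnion.1 hy
    cases m with
    | zero =>
      obtain ⟨i, rfl⟩ := hm
      refine Set.mem_iUnion.2 ⟨i, vertex i, vertex_mem_SG i, ?_⟩
      simp [contraction]
    | succ m =>
      obtain ⟨i, z, hz, rfl⟩ := Set.mem_iUnion.1 hm
      exact Set.mem_iUnion.2 ⟨i, z, subset_closure (Set.mem_iUnion.2 ⟨m, hz⟩), rfl⟩
  obtain ⟨i, y, hy, hxy⟩ := Set.mem_iUnion.1 (hsub x.2)
  exact ⟨i, ⟨y, hy⟩, Subtype.ext hxy⟩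

theorem dist_Fw (w : List (Fin 3)) (x y : SG) :
    dist (Fw w x) (Fw w y) = dist x y * (1 / 2) ^ w.length := by
  induction w with
  | nil => simp [Fw]
  | cons i w ih =>
    simp only [Fw, Function.comp, dist_F, ih, List.length_cons]
    ring

/-- Composition of a function with the `i`-th contraction of the gasket. -/
def pull (i : Fin 3) (u : C(SG, ℝ)) : C(SG, ℝ) := u.comp ⟨F i, continuous_F i⟩

@[simp] theorem pull_apply (i : Fin 3) (u : C(SG, ℝ)) (x : SG) : pull i u x = u (F i x) := rfl

/-- Continuous functions on the three cells of level one that agree at the junction points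
are the restrictions of a continuous function. -/
theorem exists_glue (g : Fin 3 → C(SG, ℝ)) (hg : ∀ i j, g i (q j) = g j (q i)) :
    ∃ G : C(SG, ℝ), ∀ i, pull i G = g i := by
  let p : C(Fin 3 × SG, SG) :=
    ⟨fun z => F z.1 z.2, continuous_prod_of_discrete_left.2 fun i => continuous_F i⟩
  let k : C(Fin 3 × SG, ℝ) :=
    ⟨fun z => g z.1 z.2, continuous_prod_of_discrete_left.2 fun i => (g i).continuous⟩
  have hsurj : Function.Surjective p := fun x => by
    obtain ⟨i, y, h⟩ := exists_F_eq x
    exact ⟨(i, y), h⟩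
  -- A continuous surjection from a compact space to a Hausdorff space is a quotient map, so it
  -- suffices that `k` is constant on the fibres of `p`.
  have hp : IsQuotientMap p := p.continuous.isClosedMap.isQuotientMap p.continuous hsurj
  have hk : Function.FactorsThrough k p := by
    rintro ⟨i, x⟩ ⟨j, y⟩ hxy
    change F i x = F j y at hxy
    change g i x = g j y
    by_cases hij : i = j
    · subst hij
      rw [F_injective i hxy]
    · rw [eq_q_of_F_eq_F hij hxy, eq_q_of_F_eq_F (Ne.symm hij) hxy.symm, hg]
  refine ⟨hp.lift k hk, fun i => ?_⟩
  ext x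
  exact DFunLike.congr_fun (hp.lift_comp k hk) (i, x)

/-! ### Graph energies -/

theorem graphEnergy_zero (u v : C(SG, ℝ)) :
    graphEnergy 0 u v = (u (q 0) - u (q 1)) * (v (q 0) - v (q 1)) +
      (u (q 0) - u (q 2)) * (v (q 0) - v (q 2)) + (u (q 1) - u (q 2)) * (v (q 1) - v (q 2)) := by
  have e0 : Finset.Ioi (0 : Fin 3) = {1, 2} := by decide
  have e1 : Finset.Ioi (1 : Fin 3) = {2} := by decide
  have e2 : Finset.Ioi (2 : Fin 3) = ∅ := by decide
  simp [graphEnergy, Fin.sum_univ_three, e0, e1, e2, Fw]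

/-- Self-similarity, by splitting off the first letter of each word; it drives the inductions on the
level. -/
theorem graphEnergy_succ (m : ℕ) (u v : C(SG, ℝ)) :
    graphEnergy (m + 1) u v = 5 / 3 * ∑ i, graphEnergy m (pull i u) (pull i v) := by
  unfold graphEnergy
  rw [← Finset.mul_sum, pow_succ, mul_comm ((5 / 3 : ℝ) ^ m), mul_assoc]
  congr 2
  rw [← (Fin.consEquiv fun _ : Fin (m + 1) => Fin 3).sum_comp, Fintype.sum_prod_type]
  refine Finset.sum_congr rfl fun i _ => Finset.sum_congr rfl fun w _ => ?_
  simp [Fin.consEquiv, List.ofFn_succ, Fw]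

theorem graphEnergy_comm (m : ℕ) (u v : C(SG, ℝ)) : graphEnergy m u v = graphEnergy m v u := by
  simp only [graphEnergy, mul_comm]

theorem graphEnergy_add_left (m : ℕ) (u v w : C(SG, ℝ)) :
    graphEnergy m (u + v) w = graphEnergy m u w + graphEnergy m v w := by
  simp only [graphEnergy, ← mul_add, ← Finset.sum_add_distrib]
  congr 1
  refine Finset.sum_congr rfl fun _ _ => Finset.sum_congr rfl fun _ _ =>
    Finset.sum_congr rfl fun _ _ => ?_
  simp only [ContinuousMap.add_apply]
  ring

theorem graphEnergy_smul_left (m : ℕ) (c : ℝ) (u w : C(SG, ℝ)) :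
    graphEnergy m (c • u) w = c * graphEnergy m u w := by
  simp only [graphEnergy, Finset.mul_sum]
  refine Finset.sum_congr rfl fun _ _ => Finset.sum_congr rfl fun _ _ =>
    Finset.sum_congr rfl fun _ _ => ?_
  simp only [ContinuousMap.smul_apply, smul_eq_mul]
  ring

theorem graphEnergy_add_right (m : ℕ) (u v w : C(SG, ℝ)) :
    graphEnergy m u (v + w) = graphEnergy m u v + graphEnergy m u w := by
  rw [graphEnergy_comm, graphEnergy_add_left, graphEnergy_comm m v, graphEnergy_comm m w]

theorem graphEnergy_smul_right (m : ℕ) (c : ℝ) (u w : C(SG, ℝ)) :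
    graphEnergy m u (c • w) = c * graphEnergy m u w := by
  rw [graphEnergy_comm, graphEnergy_smul_left, graphEnergy_comm]

theorem graphEnergy_self_nonneg (m : ℕ) (u : C(SG, ℝ)) : 0 ≤ graphEnergy m u u := by
  unfold graphEnergy
  refine mul_nonneg (by positivity) (Finset.sum_nonneg fun _ _ => Finset.sum_nonneg fun _ _ =>
    Finset.sum_nonneg fun _ _ => mul_self_nonneg _)

theorem graphEnergy_zero_le_one (u : C(SG, ℝ)) : graphEnergy 0 u u ≤ graphEnergy 1 u u := by
  rw [graphEnergy_succ, Fin.sum_univ_three]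
  simp only [graphEnergy_zero, pull_apply, F_q_self, F_q_comm 1 0, F_q_comm 2 0, F_q_comm 2 1]
  generalize u (q 0) = a
  generalize u (q 1) = b
  generalize u (q 2) = c
  generalize u (F 0 (q 1)) = z
  generalize u (F 0 (q 2)) = y
  generalize u (F 1 (q 2)) = x
  -- Completing the square about the minimizing midpoint values (the 2/5, 2/5, 1/5 rule); with the
  -- factor 5/3 the minimum is exactly the level-zero energy.
  have key : 5 / 3 *
      ((a - z) * (a - z) + (a - y) * (a - y) + (z - y) * (z - y) +
        ((z - b) * (z - b) + (z - x) * (z - x) + (b - x) * (b - x)) +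
        ((y - x) * (y - x) + (y - c) * (y - c) + (x - c) * (x - c))) -
      ((a - b) * (a - b) + (a - c) * (a - c) + (b - c) * (b - c)) =
      5 / 3 * ((z - (2 * a + 2 * b + c) / 5) ^ 2 * 2 + (y - (2 * a + b + 2 * c) / 5) ^ 2 * 2 +
        (x - (a + 2 * b + 2 * c) / 5) ^ 2 * 2 +
        ((z - (2 * a + 2 * b + c) / 5) - (y - (2 * a + b + 2 * c) / 5)) ^ 2 +
        ((z - (2 * a + 2 * b + c) / 5) - (x - (a + 2 * b + 2 * c) / 5)) ^ 2 +
        ((y - (2 * a + b + 2 * c) / 5) - (x - (a + 2 * b + 2 * c) / 5)) ^ 2) := by ring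
  rw [← sub_nonneg, key]
  positivity

theorem graphEnergy_le_succ (m : ℕ) (u : C(SG, ℝ)) :
    graphEnergy m u u ≤ graphEnergy (m + 1) u u := by
  induction m generalizing u with
  | zero => exact graphEnergy_zero_le_one u
  | succ m ih =>
    rw [graphEnergy_succ, graphEnergy_succ (m + 1)]
    gcongr with i
    exact ih _

theorem monotone_graphEnergy (u : C(SG, ℝ)) : Monotone fun m => graphEnergy m u u :=
  monotone_nat_of_le_succ fun m => graphEnergy_le_succ m u

/-! ### Density of the vertices -/

theorem exists_Fw_eq (m : ℕ) (x : SG) : ∃ w : List (Fin 3), w.length = m ∧ ∃ y, Fw w y = x := by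
  induction m generalizing x with
  | zero => exact ⟨[], rfl, x, rfl⟩
  | succ m ih =>
    obtain ⟨i, y, rfl⟩ := exists_F_eq x
    obtain ⟨w, hw, z, rfl⟩ := ih y
    exact ⟨i :: w, by simp [hw], z, rfl⟩

theorem exists_two_mul_half_pow_lt {ε : ℝ} (hε : 0 < ε) : ∃ m : ℕ, 2 * (1 / 2 : ℝ) ^ m < ε := by
  obtain ⟨m, hm⟩ := exists_pow_lt_of_lt_one (half_pos hε) (by norm_num : (1 / 2 : ℝ) < 1)
  exact ⟨m, by linarith⟩

theorem dist_Fw_le (w : List (Fin 3)) (x y : SG) :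
    dist (Fw w x) (Fw w y) ≤ 2 * (1 / 2) ^ w.length := by
  rw [dist_Fw]
  gcongr
  exact dist_le_two x y

/-- A closed set that contains all vertices is the whole gasket. -/
theorem mem_of_isClosed_of_vertices {C : Set SG} (hC : IsClosed C)
    (h : ∀ w i, Fw w (q i) ∈ C) (x : SG) : x ∈ C := by
  rw [← hC.closure_eq]
  refine Metric.mem_closure_iff.2 fun ε hε => ?_
  obtain ⟨m, hm⟩ := exists_two_mul_half_pow_lt hε
  obtain ⟨w, hw, y, rfl⟩ := exists_Fw_eq m x
  exact ⟨Fw w (q 0), h w 0, (dist_Fw_le w y (q 0)).trans_lt (hw ▸ hm)⟩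

/-! ### Harmonic functions -/

/-- The values at the corners of the `i`-th cell of the harmonic function with boundary
values `b`. -/
def extend (i : Fin 3) (b : Fin 3 → ℝ) : Fin 3 → ℝ :=
  fun j => if i = j then b i else (b 0 + b 1 + b 2 + b i + b j) / 5

theorem extend_comm (i j : Fin 3) (b : Fin 3 → ℝ) : extend i b j = extend j b i := by
  unfold extend
  rcases eq_or_ne i j with rfl | hij
  · simp
  · rw [if_neg hij, if_neg hij.symm]
    ring

theorem extend_self (i : Fin 3) (b : Fin 3 → ℝ) : extend i b i = b i := by simp [extend]

theorem extend_le {b : Fin 3 → ℝ} {c : ℝ} (hb : ∀ i, b i ≤ c) (i j : Fin 3) :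
    extend i b j ≤ c := by
  unfold extend
  split_ifs
  · exact hb i
  · linarith [hb 0, hb 1, hb 2, hb i, hb j]

theorem le_extend {b : Fin 3 → ℝ} {c : ℝ} (hb : ∀ i, c ≤ b i) (i j : Fin 3) :
    c ≤ extend i b j := by
  unfold extend
  split_ifs
  · exact hb i
  · linarith [hb 0, hb 1, hb 2, hb i, hb j]

/-- The factor 3/5 is the geometric rate at which the harmonic extension algorithm converges. -/
theorem extend_osc_le {b : Fin 3 → ℝ} {δ : ℝ} (hb : ∀ i j, b i - b j ≤ δ) (i j k : Fin 3) :
    extend i b j - extend i b k ≤ 3 / 5 * δ := by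
  have h01 := hb 0 1
  have h02 := hb 0 2
  have h10 := hb 1 0
  have h12 := hb 1 2
  have h20 := hb 2 0
  have h21 := hb 2 1
  fin_cases i <;> fin_cases j <;> fin_cases k <;> simp [extend] <;> linarith

/-- The affine function with values `b` at the corners. -/
def affine (b : Fin 3 → ℝ) : C(SG, ℝ) :=
  ⟨fun x => b 0 * bary x 0 + b 1 * bary x 1 + b 2 * bary x 2, by
    have := fun k => (continuous_bary k).comp (continuous_subtype_val (p := fun x => x ∈ SG))
    exact (((this 0).const_mul _).add ((this 1).const_mul _)).add ((this 2).const_mul _)⟩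

theorem affine_apply (b : Fin 3 → ℝ) (x : SG) :
    affine b x = b 0 * bary x 0 + b 1 * bary x 1 + b 2 * bary x 2 := rfl

theorem affine_q (b : Fin 3 → ℝ) (j : Fin 3) : affine b (q j) = b j := by
  rw [affine_apply]
  simp only [q, bary_vertex]
  fin_cases j <;> simp

/-- Both functions are affine in `y`, so their difference is the convex combination, with weights
`bary y k`, of its values at the corners. -/
theorem abs_affine_sub_affine_extend_le {b : Fin 3 → ℝ} {δ : ℝ} (hb : ∀ i j, b i - b j ≤ δ)
    (i : Fin 3) (y : SG) : |affine b (F i y) - affine (extend i b) y| ≤ δ := by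
  have hl := bary_nonneg y.2
  have hs := sum_bary y
  have hd : ∀ k, |(b k + b i) / 2 - extend i b k| ≤ δ := by
    have h01 := hb 0 1
    have h02 := hb 0 2
    have h10 := hb 1 0
    have h12 := hb 1 2
    have h20 := hb 2 0
    have h21 := hb 2 1
    intro k
    rw [abs_le]
    constructor <;> fin_cases i <;> fin_cases k <;> simp [extend] <;> linarith
  have e : affine b (F i y) - affine (extend i b) y =
      ∑ k, bary y k * ((b k + b i) / 2 - extend i b k) := by
    rw [Fin.sum_univ_three, affine_apply, affine_apply]
    simp only [F, bary_contraction, bary_vertex]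
    have hi : b 0 * (if i = 0 then 1 else 0) + b 1 * (if i = 1 then 1 else 0) +
        b 2 * (if i = 2 then 1 else 0) = b i := by
      fin_cases i <;> simp
    linear_combination (1 / 2) * hi - b i / 2 * hs
  calc |affine b (F i y) - affine (extend i b) y|
      ≤ ∑ k, |bary y k * ((b k + b i) / 2 - extend i b k)| := by
        rw [e]; exact Finset.abs_sum_le_sum_abs _ _
    _ ≤ ∑ k, bary y k * δ := by
        refine Finset.sum_le_sum fun k _ => ?_
        rw [abs_mul, abs_of_nonneg (hl k)]
        exact mul_le_mul_of_nonneg_left (hd k) (hl k)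
    _ = δ := by rw [← Finset.sum_mul, Fin.sum_univ_three, hs, one_mul]

/-- Existence of harmonic functions, by the harmonic extension algorithm. -/
theorem exists_harmonicExtension : ∃ H : (Fin 3 → ℝ) → C(SG, ℝ),
    (∀ b j, H b (q j) = b j) ∧ ∀ b i, pull i (H b) = H (extend i b) := by
  let B := {φ : (Fin 3 → ℝ) → C(SG, ℝ) // ∀ b j, φ b (q j) = b j}
  -- One step of the algorithm: prescribe the corner values of the three cells by `extend`, fill
  -- each cell with `φ`, and glue. The harmonic extension is a fixed point of this step.
  have hstep : ∀ φ : B, ∃ ψ : B, ∀ b i, pull i (ψ.1 b) = φ.1 (extend i b) := by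
    intro φ
    have hφ : ∀ b, ∃ G : C(SG, ℝ), ∀ i, pull i G = φ.1 (extend i b) := fun b =>
      exists_glue (fun i => φ.1 (extend i b)) fun i j => by
        rw [φ.2, φ.2, extend_comm]
    choose ψ hψ using hφ
    refine ⟨⟨ψ, fun b j => ?_⟩, hψ⟩
    have := DFunLike.congr_fun (hψ b j) (q j)
    rwa [pull_apply, F_q_self, φ.2, extend_self] at this
  choose step hstep using hstep
  let s : ℕ → B := fun n => step^[n] ⟨affine, affine_q⟩
  have hs0 : (s 0).1 = affine := rfl
  have hs : ∀ n b i, pull i ((s (n + 1)).1 b) = (s n).1 (extend i b) := fun n b i => by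
    simp only [s, Function.iterate_succ_apply', hstep]
  -- On the `i`-th cell the distance at stage `n + 1` is that at stage `n` for the data `extend i
  -- b`, whose oscillation is smaller by the factor 3/5.
  have hdist : ∀ n (b : Fin 3 → ℝ) δ, (∀ i j, b i - b j ≤ δ) →
      dist ((s n).1 b) ((s (n + 1)).1 b) ≤ δ * (3 / 5) ^ n := by
    intro n
    induction n with
    | zero =>
      intro b δ hb
      have hδ : 0 ≤ δ := by simpa using hb 0 0
      rw [ContinuousMap.dist_le (by positivity)]
      intro x
      obtain ⟨i, y, rfl⟩ := exists_F_eq x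
      rw [← pull_apply i ((s (0 + 1)).1 b), hs, hs0, Real.dist_eq, pow_zero, mul_one]
      exact abs_affine_sub_affine_extend_le hb i y
    | succ n ih =>
      intro b δ hb
      have hδ : 0 ≤ δ := by simpa using hb 0 0
      rw [ContinuousMap.dist_le (by positivity)]
      intro x
      obtain ⟨i, y, rfl⟩ := exists_F_eq x
      rw [← pull_apply i ((s (n + 1)).1 b), ← pull_apply i ((s (n + 1 + 1)).1 b), hs, hs]
      refine (ContinuousMap.dist_apply_le_dist y).trans
        ((ih _ _ fun j k => extend_osc_le hb i j k).trans (le_of_eq ?_))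
      ring
  have hlim : ∀ b, ∃ H : C(SG, ℝ), Tendsto (fun n => (s n).1 b) atTop (𝓝 H) := fun b => by
    have hb : ∀ i j, b i - b j ≤ 2 * ‖b‖ := fun i j => by
      have h1 := norm_le_pi_norm b i
      have h2 := norm_le_pi_norm b j
      rw [Real.norm_eq_abs] at h1 h2
      linarith [le_abs_self (b i), neg_abs_le (b j)]
    exact cauchySeq_tendsto_of_complete
      (cauchySeq_of_le_geometric (3 / 5) (2 * ‖b‖) (by norm_num) fun n => hdist n b _ hb)
  choose H hH using hlim
  have hHx : ∀ b x, Tendsto (fun n => (s n).1 b x) atTop (𝓝 (H b x)) := fun b x =>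
    ((continuous_eval_const x).tendsto _).comp (hH b)
  refine ⟨H, fun b j => ?_, fun b i => ?_⟩
  · refine tendsto_nhds_unique (hHx b (q j)) ?_
    simp only [(s _).2]
    exact tendsto_const_nhds
  · ext x
    refine tendsto_nhds_unique ((tendsto_add_atTop_iff_nat 1).2 (hHx b (F i x))) ?_
    simp only [← pull_apply, hs]
    exact hHx _ x

/-- The function with boundary values `b` given by the harmonic extension algorithm. -/
def harmonicExtension : (Fin 3 → ℝ) → C(SG, ℝ) := exists_harmonicExtension.choose

theorem harmonicExtension_q (b : Fin 3 → ℝ) (j : Fin 3) : harmonicExtension b (q j) = b j :=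
  exists_harmonicExtension.choose_spec.1 b j

theorem pull_harmonicExtension (b : Fin 3 → ℝ) (i : Fin 3) :
    pull i (harmonicExtension b) = harmonicExtension (extend i b) :=
  exists_harmonicExtension.choose_spec.2 b i

/-- Maximum principle: `extend` takes averages, so the bounds pass to every vertex, and the vertices
are dense. -/
theorem harmonicExtension_mem_Icc {b : Fin 3 → ℝ} {c d : ℝ} (hc : ∀ i, c ≤ b i)
    (hd : ∀ i, b i ≤ d) (x : SG) : harmonicExtension b x ∈ Set.Icc c d := by
  refine mem_of_isClosed_of_vertices (C := harmonicExtension b ⁻¹' Set.Icc c d)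
    (isClosed_Icc.preimage (harmonicExtension b).continuous) (fun w i => ?_) x
  induction w generalizing b with
  | nil =>
    rw [Set.mem_preimage, Fw, id, harmonicExtension_q]
    exact ⟨hc i, hd i⟩
  | cons j w ih =>
    have := ih (le_extend hc j) (extend_le hd j)
    rwa [Set.mem_preimage, ← pull_harmonicExtension] at this

/-- The equality case of `graphEnergy_zero_le_one`, repeated in every cell. -/
theorem graphEnergy_harmonicExtension (m : ℕ) (b : Fin 3 → ℝ) :
    graphEnergy m (harmonicExtension b) (harmonicExtension b) =
      graphEnergy 0 (harmonicExtension b) (harmonicExtension b) := by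
  induction m generalizing b with
  | zero => rfl
  | succ m ih =>
    rw [graphEnergy_succ]
    simp only [pull_harmonicExtension, ih]
    rw [Fin.sum_univ_three]
    simp only [graphEnergy_zero, harmonicExtension_q]
    simp [extend]
    ring

theorem graphEnergy_zero_congr {u v : C(SG, ℝ)} (huv : ∀ i, u (q i) = v (q i)) :
    graphEnergy 0 u u = graphEnergy 0 v v := by
  simp only [graphEnergy_zero, huv]

theorem isHarmonic_harmonicExtension (b : Fin 3 → ℝ) : IsHarmonic (harmonicExtension b) := by
  intro m v hv
  rw [graphEnergy_harmonicExtension, ← graphEnergy_zero_congr hv]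
  exact monotone_graphEnergy v (Nat.zero_le m)

/-- Existence alone justifies the choice in `h`; uniqueness is not needed, since only these two
properties of `h j` are used. -/
theorem h_spec (j : Fin 3) : IsHarmonic (h j) ∧ ∀ i, h j (q i) = if i = j then 1 else 0 :=
  Classical.epsilon_spec
    (p := fun u : C(SG, ℝ) => IsHarmonic u ∧ ∀ i, u (q i) = if i = j then 1 else 0)
    ⟨harmonicExtension fun i => if i = j then 1 else 0, isHarmonic_harmonicExtension _,
      fun i => harmonicExtension_q _ i⟩

theorem harmonicExtension_mem_domEnergy (b : Fin 3 → ℝ) : harmonicExtension b ∈ domEnergy := by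
  refine ⟨graphEnergy 0 (harmonicExtension b) (harmonicExtension b), ?_⟩
  rintro _ ⟨m, rfl⟩
  exact (graphEnergy_harmonicExtension m b).le

theorem IsHarmonic.mem_domEnergy {u : C(SG, ℝ)} (hu : IsHarmonic u) : u ∈ domEnergy := by
  obtain ⟨M, hM⟩ := harmonicExtension_mem_domEnergy fun i => u (q i)
  refine ⟨M, ?_⟩
  rintro _ ⟨m, rfl⟩
  exact (hu m _ fun i => harmonicExtension_q _ i).trans (hM ⟨m, rfl⟩)

/-- A harmonic function is orthogonal to all functions that vanish on the boundary. -/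
theorem IsHarmonic.graphEnergy_eq_zero {u v : C(SG, ℝ)} (hu : IsHarmonic u)
    (hv : ∀ i, v (q i) = 0) (m : ℕ) : graphEnergy m u v = 0 := by
  have hk := graphEnergy_self_nonneg m v
  have h1 : ∀ t : ℝ, 0 ≤ 2 * t * graphEnergy m u v + t ^ 2 * graphEnergy m v v := fun t => by
    have := hu m (u + t • v) fun i => by simp [hv]
    simp only [graphEnergy_add_left, graphEnergy_add_right, graphEnergy_smul_left,
      graphEnergy_smul_right, graphEnergy_comm m v u] at this
    linarith
  generalize graphEnergy m v v = k at h1 hk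
  generalize graphEnergy m u v = e at h1
  have hk1 : 0 < k + 1 := by linarith
  -- The optimal `t` would be `-e / k`; the denominator `k + 1` also covers `k = 0`.
  have h2 := h1 (-e / (k + 1))
  have e2 : 2 * (-e / (k + 1)) * e + (-e / (k + 1)) ^ 2 * k =
      -(e ^ 2 * ((k + 2) / (k + 1) ^ 2)) := by
    field_simp
    ring
  rw [e2] at h2
  have hpos : 0 < (k + 2) / (k + 1) ^ 2 := by positivity
  have h3 : e ^ 2 ≤ 0 := by
    by_contra hcon
    have := mul_pos (not_le.1 hcon) hpos
    linarith
  exact pow_eq_zero_iff (two_ne_zero) |>.1 (le_antisymm h3 (sq_nonneg e))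

/-! ### Functions of finite energy -/

theorem add_mem_domEnergy {u v : C(SG, ℝ)} (hu : u ∈ domEnergy) (hv : v ∈ domEnergy) :
    u + v ∈ domEnergy := by
  obtain ⟨M, hM⟩ := hu
  obtain ⟨N, hN⟩ := hv
  refine ⟨2 * M + 2 * N, ?_⟩
  rintro _ ⟨m, rfl⟩
  have h1 := hM ⟨m, rfl⟩
  have h2 := hN ⟨m, rfl⟩
  -- Parallelogram law: the energies of `u + v` and `u - v` add up to twice those of `u` and `v`.
  have h3 := graphEnergy_self_nonneg m (u + (-1 : ℝ) • v)
  simp only [graphEnergy_add_left, graphEnergy_add_right, graphEnergy_smul_left,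
    graphEnergy_smul_right, graphEnergy_comm m v u] at *
  linarith

theorem smul_mem_domEnergy (c : ℝ) {u : C(SG, ℝ)} (hu : u ∈ domEnergy) :
    c • u ∈ domEnergy := by
  obtain ⟨M, hM⟩ := hu
  refine ⟨c * c * M, ?_⟩
  rintro _ ⟨m, rfl⟩
  simp only [graphEnergy_smul_left, graphEnergy_smul_right, ← mul_assoc]
  exact mul_le_mul_of_nonneg_left (hM ⟨m, rfl⟩) (mul_self_nonneg c)

theorem mem_domEnergy_of_pull {u : C(SG, ℝ)} (hu : ∀ i, pull i u ∈ domEnergy) :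
    u ∈ domEnergy := by
  choose M hM using hu
  refine ⟨5 / 3 * ∑ i, M i, ?_⟩
  rintro _ ⟨m, rfl⟩
  -- Passing to level `m + 1` avoids a separate case for level zero.
  refine (graphEnergy_le_succ m u).trans ?_
  rw [graphEnergy_succ]
  gcongr with i
  exact hM i ⟨m, rfl⟩

/-- The energy form `ℰ`. -/
def energy (u v : C(SG, ℝ)) : ℝ := limUnder atTop fun m => graphEnergy m u v

/-- Polarization: on the diagonal the sequence is monotone and bounded. -/
theorem tendsto_energy {u v : C(SG, ℝ)} (hu : u ∈ domEnergy) (hv : v ∈ domEnergy) :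
    Tendsto (fun m => graphEnergy m u v) atTop (𝓝 (energy u v)) := by
  have hself : ∀ {w : C(SG, ℝ)}, w ∈ domEnergy →
      ∃ L, Tendsto (fun m => graphEnergy m w w) atTop (𝓝 L) := fun {w} hw =>
    ⟨_, tendsto_atTop_ciSup (monotone_graphEnergy w) hw⟩
  obtain ⟨L₁, h₁⟩ := hself (add_mem_domEnergy hu hv)
  obtain ⟨L₂, h₂⟩ := hself hu
  obtain ⟨L₃, h₃⟩ := hself hv
  have hL : Tendsto (fun m => graphEnergy m u v) atTop (𝓝 ((L₁ - L₂ - L₃) / 2)) := by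
    refine (((h₁.sub h₂).sub h₃).div_const 2).congr fun m => ?_
    simp only [graphEnergy_add_left, graphEnergy_add_right, graphEnergy_comm m v u]
    ring
  exact tendsto_nhds_limUnder ⟨_, hL⟩

theorem graphEnergy_le_energy {u : C(SG, ℝ)} (hu : u ∈ domEnergy) (m : ℕ) :
    graphEnergy m u u ≤ energy u u :=
  (monotone_graphEnergy u).ge_of_tendsto (tendsto_energy hu hu) m

theorem abs_sub_le_of_graphEnergy_zero {u : C(SG, ℝ)} {d : ℝ} (hd : 0 ≤ d)
    (hu : graphEnergy 0 u u ≤ d ^ 2) (i : Fin 3) : |u (q i) - u (q 0)| ≤ d := by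
  rw [graphEnergy_zero] at hu
  refine abs_le_of_sq_le_sq ?_ hd
  fin_cases i
  · simp; positivity
  · simp only [Fin.mk_one]
    nlinarith [mul_self_nonneg (u (q 0) - u (q 2)), mul_self_nonneg (u (q 1) - u (q 2))]
  · simp only [Fin.reduceFinMk]
    nlinarith [mul_self_nonneg (u (q 0) - u (q 1)), mul_self_nonneg (u (q 1) - u (q 2))]

/-- The oscillation of a function is controlled by its energy. -/
theorem abs_sub_le_of_graphEnergy {u : C(SG, ℝ)} {d : ℝ} (hd : 0 ≤ d)
    (hu : ∀ m, graphEnergy m u u ≤ d ^ 2) (x : SG) : |u x - u (q 0)| ≤ 4 * d := by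
  refine mem_of_isClosed_of_vertices (C := {x | |u x - u (q 0)| ≤ 4 * d})
    (isClosed_le (by fun_prop) continuous_const) (fun w i => ?_) x
  change |u (Fw w (q i)) - u (q 0)| ≤ 4 * d
  induction w generalizing u d with
  | nil =>
    have := abs_sub_le_of_graphEnergy_zero hd (hu 0) i
    simp only [Fw, id]
    linarith
  | cons j w ih =>
    -- Each cell carries at most 3/5 of the energy bound. The ratio `r = 31/40` satisfies `r ^ 2 ≥
    -- 3/5` and `4 * r + r ≤ 4`, which closes the induction with the constant 4.
    have hp : ∀ k m, graphEnergy m (pull k u) (pull k u) ≤ (31 / 40 * d) ^ 2 := fun k m => by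
      have h1 := hu (m + 1)
      rw [graphEnergy_succ] at h1
      have h2 := Finset.single_le_sum
        (f := fun i => graphEnergy m (pull i u) (pull i u))
        (fun i _ => graphEnergy_self_nonneg m (pull i u)) (Finset.mem_univ k)
      nlinarith [sq_nonneg d]
    have hd' : 0 ≤ 31 / 40 * d := by positivity
    have h1 := ih hd' (hp j)
    -- The junction point `F j (q 0) = F 0 (q j)` is joined to `q 0` inside cell 0.
    have h2 := abs_sub_le_of_graphEnergy_zero hd' (hp 0 0) j
    simp only [pull_apply, F_q_self, F_q_comm 0 j] at h1 h2
    simp only [Fw, Function.comp]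
    have := abs_sub_le (u (F j (Fw w (q i)))) (u (F j (q 0))) (u (q 0))
    linarith

/-- Piecewise harmonic interpolation. -/
theorem exists_spline (m : ℕ) (g : C(SG, ℝ)) (ε : ℝ)
    (hg : ∀ w : List (Fin 3), w.length = m → ∀ x y, |g (Fw w x) - g (Fw w y)| ≤ ε) :
    ∃ s ∈ domEnergy, (∀ i, s (q i) = g (q i)) ∧ ∀ x, |s x - g x| ≤ ε := by
  induction m generalizing g with
  | zero =>
    refine ⟨harmonicExtension fun i => g (q i), harmonicExtension_mem_domEnergy _,
      fun i => harmonicExtension_q _ i, fun x => ?_⟩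
    have h1 : ∀ i, |g (q i) - g x| ≤ ε := fun i => hg [] rfl (q i) x
    have := harmonicExtension_mem_Icc (b := fun i => g (q i)) (c := g x - ε) (d := g x + ε)
      (fun i => by linarith [(abs_le.1 (h1 i)).1]) (fun i => by linarith [(abs_le.1 (h1 i)).2]) x
    rw [abs_le]
    constructor <;> linarith [this.1, this.2]
  | succ m ih =>
    have hi := fun i => ih (pull i g) fun w hw x y => hg (i :: w) (by simp [hw]) x y
    choose s hs hsq hsx using hi
    obtain ⟨S, hS⟩ := exists_glue s fun i j => by
      rw [hsq, hsq, pull_apply, pull_apply, F_q_comm]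
    refine ⟨S, mem_domEnergy_of_pull fun i => by rw [hS]; exact hs i, fun i => ?_, fun x => ?_⟩
    · have := hsq i i
      rwa [← hS, pull_apply, pull_apply, F_q_self] at this
    · obtain ⟨i, y, rfl⟩ := exists_F_eq x
      have := hsx i y
      rwa [← hS] at this

/-- Continuous functions are uniform limits of functions of finite energy with the same
boundary values. -/
theorem exists_mem_domEnergy_abs_sub_le (g : C(SG, ℝ)) {ε : ℝ} (hε : 0 < ε) :
    ∃ s ∈ domEnergy, (∀ i, s (q i) = g (q i)) ∧ ∀ x, |s x - g x| ≤ ε := by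
  obtain ⟨δ, hδ, hgδ⟩ := Metric.uniformContinuous_iff.1
    (CompactSpace.uniformContinuous_of_continuous g.continuous) ε hε
  obtain ⟨m, hm⟩ := exists_two_mul_half_pow_lt hδ
  refine exists_spline m g ε fun w hw x y => ?_
  rw [← Real.dist_eq]
  exact (hgδ ((dist_Fw_le w x y).trans_lt (hw ▸ hm))).le

/-! ### The energy form on its domain -/

theorem energy_comm (u v : C(SG, ℝ)) : energy u v = energy v u := by
  simp only [energy, graphEnergy_comm _ u v]

theorem energy_add_left {u v w : C(SG, ℝ)} (hu : u ∈ domEnergy) (hv : v ∈ domEnergy)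
    (hw : w ∈ domEnergy) : energy (u + v) w = energy u w + energy v w := by
  refine tendsto_nhds_unique (tendsto_energy (add_mem_domEnergy hu hv) hw) ?_
  simp only [graphEnergy_add_left]
  exact (tendsto_energy hu hw).add (tendsto_energy hv hw)

theorem energy_smul_left (c : ℝ) {u w : C(SG, ℝ)} (hu : u ∈ domEnergy)
    (hw : w ∈ domEnergy) : energy (c • u) w = c * energy u w := by
  refine tendsto_nhds_unique (tendsto_energy (smul_mem_domEnergy c hu) hw) ?_
  simp only [graphEnergy_smul_left]
  exact (tendsto_energy hu hw).const_mul c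

theorem energy_self_nonneg {u : C(SG, ℝ)} (hu : u ∈ domEnergy) : 0 ≤ energy u u :=
  (graphEnergy_self_nonneg 0 u).trans (graphEnergy_le_energy hu 0)

/-- This bound makes the energy form definite and the inclusion into `C(SG, ℝ)` continuous. -/
theorem abs_le_of_mem_domEnergyZero {u : C(SG, ℝ)} (hu : u ∈ domEnergyZero) (x : SG) :
    |u x| ≤ 4 * Real.sqrt (energy u u) := by
  have := abs_sub_le_of_graphEnergy (u := u) (Real.sqrt_nonneg (energy u u))
    (fun m => by
      rw [Real.sq_sqrt (energy_self_nonneg hu.1)]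
      exact graphEnergy_le_energy hu.1 m) x
  rwa [hu.2, sub_zero] at this

theorem continuous_graphEnergy_self (m : ℕ) : Continuous fun u : C(SG, ℝ) => graphEnergy m u u := by
  unfold graphEnergy
  fun_prop

/-! ### The Hilbert space of functions of finite energy that vanish on the boundary -/

theorem zero_mem_domEnergy : (0 : C(SG, ℝ)) ∈ domEnergy := by
  have := smul_mem_domEnergy 0 (harmonicExtension_mem_domEnergy 0)
  rwa [zero_smul] at this

/-- The functions of finite energy that vanish on the boundary, as a subspace. -/
def domEnergyZeroSubmodule : Submodule ℝ C(SG, ℝ) where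
  carrier := domEnergyZero
  add_mem' hu hv := ⟨add_mem_domEnergy hu.1 hv.1, fun i => by simp [hu.2, hv.2]⟩
  zero_mem' := ⟨zero_mem_domEnergy, fun _ => rfl⟩
  smul_mem' c _ hu := ⟨smul_mem_domEnergy c hu.1, fun i => by simp [hu.2]⟩

/-- The functions of finite energy that vanish on the boundary, with the energy form as inner
product. -/
def EnergySpace : Type := domEnergyZeroSubmodule

/-- Only the algebraic structure is transported from the submodule; the norm will come from the
energy instead of the sup norm. -/
instance : AddCommGroup EnergySpace := inferInstanceAs (AddCommGroup domEnergyZeroSubmodule)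

instance : Module ℝ EnergySpace := inferInstanceAs (Module ℝ domEnergyZeroSubmodule)

/-- The inclusion of the energy space into the continuous functions, as a linear map. -/
def toContinuousMapₗ : EnergySpace →ₗ[ℝ] C(SG, ℝ) := domEnergyZeroSubmodule.subtype

theorem toContinuousMapₗ_injective : Function.Injective toContinuousMapₗ :=
  Subtype.val_injective

theorem toContinuousMapₗ_mem (u : EnergySpace) : toContinuousMapₗ u ∈ domEnergyZero := u.2

/-- The energy form is an inner product. -/
@[reducible]
def energyCore : InnerProductSpace.Core ℝ EnergySpace where
  inner u v := energy (toContinuousMapₗ u) (toContinuousMapₗ v)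
  conj_inner_symm u v := by simp only [energy_comm (toContinuousMapₗ v), conj_trivial]
  re_inner_nonneg u := energy_self_nonneg (toContinuousMapₗ_mem u).1
  add_left u v w := by
    rw [map_add]
    exact energy_add_left (toContinuousMapₗ_mem u).1 (toContinuousMapₗ_mem v).1
      (toContinuousMapₗ_mem w).1
  smul_left u v c := by
    rw [map_smul]
    exact energy_smul_left c (toContinuousMapₗ_mem u).1 (toContinuousMapₗ_mem v).1
  definite u hu := by
    apply toContinuousMapₗ_injective
    ext x
    have := abs_le_of_mem_domEnergyZero (toContinuousMapₗ_mem u) x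
    rw [hu, Real.sqrt_zero, mul_zero] at this
    simpa using this

instance : NormedAddCommGroup EnergySpace := energyCore.toNormedAddCommGroup

instance : InnerProductSpace ℝ EnergySpace := InnerProductSpace.ofCore energyCore.toCore

theorem inner_eq_energy (u v : EnergySpace) :
    inner ℝ u v = energy (toContinuousMapₗ u) (toContinuousMapₗ v) := rfl

theorem norm_eq_sqrt_energy (u : EnergySpace) :
    ‖u‖ = Real.sqrt (energy (toContinuousMapₗ u) (toContinuousMapₗ u)) := by
  rw [norm_eq_sqrt_real_inner, inner_eq_energy]

/-- The inclusion of the energy space into the continuous functions. -/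
def toContinuousMap : EnergySpace →L[ℝ] C(SG, ℝ) :=
  toContinuousMapₗ.mkContinuous 4 fun u => by
    rw [ContinuousMap.norm_le _ (by positivity), norm_eq_sqrt_energy]
    exact abs_le_of_mem_domEnergyZero (toContinuousMapₗ_mem u)

theorem toContinuousMap_mem (u : EnergySpace) : toContinuousMap u ∈ domEnergyZero := u.2

theorem exists_toContinuousMap_eq {u : C(SG, ℝ)} (hu : u ∈ domEnergyZero) :
    ∃ v : EnergySpace, toContinuousMap v = u := ⟨⟨u, hu⟩, rfl⟩

theorem toContinuousMap_injective : Function.Injective toContinuousMap :=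
  toContinuousMapₗ_injective

theorem inner_energySpace (u v : EnergySpace) :
    inner ℝ u v = energy (toContinuousMap u) (toContinuousMap v) := rfl

theorem energy_toContinuousMap_self (u : EnergySpace) :
    energy (toContinuousMap u) (toContinuousMap u) = ‖u‖ ^ 2 := by
  rw [← inner_energySpace, real_inner_self_eq_norm_sq]

/-- An energy-Cauchy sequence converges uniformly to some `U`. At a fixed level the graph energy is
continuous for uniform convergence, so the Cauchy bounds pass to `U` with constants independent of
the level. -/
instance : CompleteSpace EnergySpace := by
  refine Metric.complete_of_cauchySeq_tendsto fun u hu => ?_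
  obtain ⟨U, hU⟩ :=
    cauchySeq_tendsto_of_complete (toContinuousMap.uniformContinuous.comp_cauchySeq hu)
  have hle : ∀ ε > 0, ∃ N, ∀ n ≥ N, ∀ m,
      graphEnergy m (toContinuousMap (u n) - U) (toContinuousMap (u n) - U) ≤ ε ^ 2 := by
    intro ε hε
    obtain ⟨N, hN⟩ := Metric.cauchySeq_iff.1 hu ε hε
    refine ⟨N, fun n hn m => ?_⟩
    refine le_of_tendsto (((continuous_graphEnergy_self m).tendsto _).comp (hU.const_sub _))
      (eventually_atTop.2 ⟨N, fun k hk => ?_⟩)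
    have h1 := graphEnergy_le_energy (toContinuousMap_mem (u n - u k)).1 m
    rw [energy_toContinuousMap_self, ← dist_eq_norm, map_sub] at h1
    exact h1.trans (pow_le_pow_left₀ dist_nonneg (hN n hn k hk).le 2)
  have hU0 : U ∈ domEnergyZero := by
    constructor
    · obtain ⟨N, hN⟩ := hle 1 one_pos
      have h1 : toContinuousMap (u N) - U ∈ domEnergy := by
        refine ⟨1 ^ 2, ?_⟩
        rintro _ ⟨m, rfl⟩
        exact hN N le_rfl m
      have h2 := add_mem_domEnergy (toContinuousMap_mem (u N)).1 (smul_mem_domEnergy (-1) h1)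
      convert h2 using 1
      module
    · intro i
      refine tendsto_nhds_unique (((continuous_eval_const (q i)).tendsto _).comp hU) ?_
      refine tendsto_const_nhds.congr fun n => ?_
      exact ((toContinuousMap_mem (u n)).2 i).symm
  obtain ⟨v, rfl⟩ := exists_toContinuousMap_eq hU0
  refine ⟨v, Metric.tendsto_atTop.2 fun ε hε => ?_⟩
  obtain ⟨N, hN⟩ := hle (ε / 2) (half_pos hε)
  refine ⟨N, fun n hn => ?_⟩
  have h1 : ‖u n - v‖ ^ 2 ≤ (ε / 2) ^ 2 := by
    rw [← energy_toContinuousMap_self]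
    refine le_of_tendsto (tendsto_energy (toContinuousMap_mem _).1 (toContinuousMap_mem _).1)
      (Eventually.of_forall fun m => ?_)
    rw [map_sub]
    exact hN n hn m
  rw [dist_eq_norm]
  linarith [abs_le_of_sq_le_sq h1 (half_pos hε).le, le_abs_self ‖u n - v‖]

theorem mem_closure_domEnergyZero {g : C(SG, ℝ)} (hg : ∀ i, g (q i) = 0) :
    g ∈ closure domEnergyZero := by
  refine Metric.mem_closure_iff.2 fun ε hε => ?_
  obtain ⟨s, hs, hsq, hsx⟩ := exists_mem_domEnergy_abs_sub_le g (half_pos hε)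
  refine ⟨s, ⟨hs, fun i => by rw [hsq, hg]⟩, ?_⟩
  rw [dist_comm]
  refine ((ContinuousMap.dist_le (half_pos hε).le).2 fun x => ?_).trans_lt (half_lt_self hε)
  rw [Real.dist_eq]
  exact hsx x

/-! ### Linear combinations of the functions `h j` -/

/-- The harmonic function with boundary values `c`. -/
def harmonicFun : (Fin 3 → ℝ) →ₗ[ℝ] C(SG, ℝ) := Fintype.linearCombination ℝ h

theorem harmonic_apply (c : Fin 3 → ℝ) (x : SG) : harmonicFun c x = ∑ j, c j * h j x := by
  simp [harmonicFun, Fintype.linearCombination_apply, ContinuousMap.sum_apply]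

theorem harmonic_q (c : Fin 3 → ℝ) (i : Fin 3) : harmonicFun c (q i) = c i := by
  simp [harmonic_apply, (h_spec _).2]

theorem harmonic_mem_domEnergy (c : Fin 3 → ℝ) : harmonicFun c ∈ domEnergy := by
  simp only [harmonicFun, Fintype.linearCombination_apply, Fin.sum_univ_three]
  have := fun j => smul_mem_domEnergy (c j) (h_spec j).1.mem_domEnergy
  exact add_mem_domEnergy (add_mem_domEnergy (this 0) (this 1)) (this 2)

theorem energy_harmonic (c : Fin 3 → ℝ) {v : C(SG, ℝ)} (hv : v ∈ domEnergyZero) :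
    energy (harmonicFun c) v = 0 := by
  refine tendsto_nhds_unique (tendsto_energy (harmonic_mem_domEnergy c) hv.1) ?_
  refine tendsto_const_nhds.congr fun m => ?_
  simp only [harmonicFun, Fintype.linearCombination_apply, Fin.sum_univ_three, graphEnergy_add_left,
    graphEnergy_smul_left, (h_spec _).1.graphEnergy_eq_zero hv.2]
  ring

/-! ### The Laplacian -/

section Laplacian

variable (ζ : Measure SG) [IsFiniteMeasure ζ]

/-- The map from the energy space to `L²(ζ)`. -/
def toL2 : EnergySpace →L[ℝ] Lp ℝ 2 ζ := (ContinuousMap.toLp 2 ζ ℝ).comp toContinuousMap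

theorem inner_toLp (f : Lp ℝ 2 ζ) (g : C(SG, ℝ)) :
    inner ℝ f (ContinuousMap.toLp 2 ζ ℝ g) = ∫ x, f x * g x ∂ζ := by
  rw [L2.inner_def]
  refine integral_congr_ae ?_
  filter_upwards [ContinuousMap.coeFn_toLp (p := 2) ζ (𝕜 := ℝ) g] with x hx
  rw [hx]
  simp [mul_comm]

/-- The solution operator of `Δ_ζ u = f` with zero boundary values. -/
def green : Lp ℝ 2 ζ →L[ℝ] EnergySpace := -ContinuousLinearMap.adjoint (toL2 ζ)

/-- The weak form of `Δ_ζ u = f`, obtained from the definition of the adjoint. -/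
theorem inner_green (f : Lp ℝ 2 ζ) (v : EnergySpace) :
    inner ℝ (green ζ f) v = -inner ℝ f (toL2 ζ v) := by
  simp [green, ContinuousLinearMap.adjoint_inner_left]

/-- Subtracting the harmonic function with the same boundary values changes no energy against test
functions. The remainder lies in `EnergySpace` and has the same inner products as `green ζ f`. -/
theorem isLaplacian_iff {u : C(SG, ℝ)} {f : Lp ℝ 2 ζ} :
    IsLaplacian ζ u f ↔ u = harmonicFun (fun i => u (q i)) + toContinuousMap (green ζ f) := by
  have hG : ∀ v : EnergySpace,
      energy (toContinuousMap (green ζ f)) (toContinuousMap v) =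
        -∫ x, f x * toContinuousMap v x ∂ζ := fun v => by
    rw [← inner_energySpace, inner_green, ← inner_toLp]
    rfl
  constructor
  · rintro ⟨hu, hf⟩
    have hw : u + (-1 : ℝ) • harmonicFun (fun i => u (q i)) ∈ domEnergyZero :=
      ⟨add_mem_domEnergy hu (smul_mem_domEnergy _ (harmonic_mem_domEnergy _)),
        fun i => by simp [harmonic_q]⟩
    obtain ⟨w, hw⟩ := exists_toContinuousMap_eq hw
    have hwG : w = green ζ f := by
      refine ext_inner_right ℝ fun v => ?_
      have hv := toContinuousMap_mem v
      have h1 := tendsto_nhds_unique (tendsto_energy hu hv.1) (hf _ hv)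
      rw [inner_energySpace, inner_energySpace, hG, hw,
        energy_add_left hu (smul_mem_domEnergy _ (harmonic_mem_domEnergy _)) hv.1,
        energy_smul_left _ (harmonic_mem_domEnergy _) hv.1, energy_harmonic _ hv, h1]
      ring
    rw [← hwG, hw]
    module
  · intro hu
    have hGm := (toContinuousMap_mem (green ζ f)).1
    have hud : u ∈ domEnergy := by
      rw [hu]
      exact add_mem_domEnergy (harmonic_mem_domEnergy _) hGm
    refine ⟨hud, fun v hv => ?_⟩
    have h1 := tendsto_energy hud hv.1
    obtain ⟨w, rfl⟩ := exists_toContinuousMap_eq hv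
    rw [hu, energy_add_left (harmonic_mem_domEnergy _) hGm hv.1, energy_harmonic _ hv, zero_add,
      hG, ← hu] at h1
    exact h1

theorem isLaplacian_harmonic_add_green (c : Fin 3 → ℝ) (f : Lp ℝ 2 ζ) :
    IsLaplacian ζ (harmonicFun c + toContinuousMap (green ζ f)) f := by
  rw [isLaplacian_iff]
  congr 2
  ext i
  simp [harmonic_q, (toContinuousMap_mem (green ζ f)).2]

/-- The functions of finite energy that vanish on the boundary are dense in `L²(ζ)`. -/
theorem eq_zero_of_inner_toL2 (hζ : ∀ x : SG, ζ {x} = 0) {f : Lp ℝ 2 ζ}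
    (hf : ∀ v, inner ℝ f (toL2 ζ v) = 0) : f = 0 := by
  have h1 : ∀ g : C(SG, ℝ), (∀ i, g (q i) = 0) →
      inner ℝ f (ContinuousMap.toLp 2 ζ ℝ g) = 0 := by
    intro g hg
    have hcl : IsClosed {g : C(SG, ℝ) | inner ℝ f (ContinuousMap.toLp 2 ζ ℝ g) = 0} :=
      isClosed_eq (by fun_prop) continuous_const
    refine closure_minimal (fun v hv => ?_) hcl (mem_closure_domEnergyZero hg)
    obtain ⟨w, rfl⟩ := exists_toContinuousMap_eq hv
    exact hf w
  -- A weight vanishing only at the boundary: `w * g` is admissible for every continuous `g`, so `w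
  -- * f` is orthogonal to a dense set. The boundary is a null set, so `f` vanishes too.
  let w : C(SG, ℝ) := ⟨fun x => ∏ i, dist x (q i), by fun_prop⟩
  have hw : MemLp w ⊤ ζ :=
    memLp_top_of_bound w.continuous.aestronglyMeasurable ‖w‖
      (Eventually.of_forall fun x => w.norm_coe_le_norm x)
  have hwf : MemLp (fun x => w x * f x) 2 ζ := (Lp.memLp f).mul hw
  have h2 : hwf.toLp = 0 := by
    refine (ContinuousMap.toLp_denseRange (p := 2) ℝ ζ ℝ (by norm_num)).eq_zero_of_inner_left ℝ ?_
    intro g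
    rw [← h1 (w * g) fun i => by
      have : w (q i) = 0 :=
        Finset.prod_eq_zero (f := fun j => dist (q i) (q j)) (Finset.mem_univ i) (dist_self (q i))
      simp [this]]
    rw [inner_toLp, inner_toLp]
    refine integral_congr_ae ?_
    filter_upwards [hwf.coeFn_toLp] with x hx
    rw [hx, ContinuousMap.mul_apply]
    ring
  rw [Lp.eq_zero_iff_ae_eq_zero] at h2 ⊢
  have h3 : ∀ᵐ x ∂ζ, ∀ i, x ≠ q i :=
    ae_all_iff.2 fun i => by rw [ae_iff]; simpa using hζ (q i)
  filter_upwards [h2, hwf.coeFn_toLp, h3] with x hx1 hx2 hx3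
  rw [hx2] at hx1
  refine (mul_eq_zero.1 hx1).resolve_left ?_
  exact (Finset.prod_ne_zero_iff (s := Finset.univ)).2 fun i _ => dist_ne_zero.2 (hx3 i)

theorem IsLaplacian.unique (hζ : ∀ x : SG, ζ {x} = 0) {u : C(SG, ℝ)} {f g : Lp ℝ 2 ζ}
    (hf : IsLaplacian ζ u f) (hg : IsLaplacian ζ u g) : f = g := by
  rw [isLaplacian_iff] at hf hg
  have h1 : green ζ f = green ζ g :=
    toContinuousMap_injective (add_left_cancel (hf.symm.trans hg))
  refine sub_eq_zero.1 (eq_zero_of_inner_toL2 ζ hζ fun v => ?_)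
  rw [← neg_eq_zero, ← inner_green, map_sub, h1, sub_self, inner_zero_left]

theorem IsLaplacian.laplacian_eq (hζ : ∀ x : SG, ζ {x} = 0) {u : C(SG, ℝ)} {f : Lp ℝ 2 ζ}
    (hf : IsLaplacian ζ u f) : laplacian ζ u = f := by
  have hex : ∃ f, IsLaplacian ζ u f := ⟨f, hf⟩
  rw [laplacian, dif_pos hex]
  exact hex.choose_spec.unique ζ hζ hf

theorem IsLaplacian.T_eq (hζ : ∀ x : SG, ζ {x} = 0) {u : C(SG, ℝ)} {f : Lp ℝ 2 ζ}
    (hf : IsLaplacian ζ u f) : T ζ u = ‖f‖ ^ 2 := by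
  rw [T, hf.laplacian_eq ζ hζ, ← real_inner_self_eq_norm_sq, L2.inner_def]
  simp

/-! ### Interpolation -/

/-- Restriction of continuous functions to a finite set. -/
def restrictTo (E : Finset SG) : C(SG, ℝ) →L[ℝ] (E → ℝ) :=
  ContinuousLinearMap.pi fun x => ContinuousMap.evalCLM ℝ (x : SG)

theorem restrictTo_apply (E : Finset SG) (u : C(SG, ℝ)) (x : E) :
    restrictTo E u x = u x := rfl

theorem restrictTo_surjective (E : Finset SG) : Function.Surjective (restrictTo E) := by
  intro a
  obtain ⟨g, hg⟩ := ContinuousMap.exists_restrict_eq (s := (E : Set SG)) E.finite_toSet.isClosed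
    ⟨a, continuous_of_discreteTopology⟩
  exact ⟨g, funext fun x => DFunLike.congr_fun hg x⟩

/-- A continuous functional on the energy space that vanishes on the range of the solution
operator vanishes. -/
theorem eq_zero_of_comp_green [ζ.IsOpenPosMeasure] {φ : EnergySpace →L[ℝ] ℝ}
    (hφ : ∀ f, φ (green ζ f) = 0) : φ = 0 := by
  have h1 : ∀ v, φ v = inner ℝ ((InnerProductSpace.toDual ℝ EnergySpace).symm φ) v := fun v =>
    InnerProductSpace.toDual_symm_apply.symm
  have h2 : toL2 ζ ((InnerProductSpace.toDual ℝ EnergySpace).symm φ) = 0 := by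
    -- The Riesz representative of `φ` is orthogonal to the range of `green`, hence zero in `L²(ζ)`;
    -- by positivity of the measure on open sets it is then zero as a continuous function.
    refine ext_inner_left ℝ fun f => ?_
    rw [inner_zero_right, ← neg_eq_zero, ← inner_green, real_inner_comm, ← h1, hφ]
  have h3 : (InnerProductSpace.toDual ℝ EnergySpace).symm φ = 0 :=
    toContinuousMap_injective (ContinuousMap.toLp_injective (p := 2) (𝕜 := ℝ) ζ (by
      rw [map_zero, map_zero]
      exact h2))
  ext v
  rw [h1, h3, inner_zero_left, zero_apply]

/-- If some values were not attained, a nonzero functional `φ` on `E → ℝ` would kill all attained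
ones. Then `φ ∘ restrictTo E` vanishes on the range of `green`, so on `EnergySpace`, so by density
on all continuous functions vanishing on the boundary. It also vanishes on harmonic functions, hence
everywhere, although restriction to `E` is onto. -/
theorem exists_interpolation [ζ.IsOpenPosMeasure] (E : Finset SG) (a : E → ℝ) :
    ∃ c f, restrictTo E (harmonicFun c + toContinuousMap (green ζ f)) = a := by
  let Λ : (Fin 3 → ℝ) × Lp ℝ 2 ζ →ₗ[ℝ] (E → ℝ) :=
    (restrictTo E).toLinearMap ∘ₗ
      harmonicFun.coprod (toContinuousMap.comp (green ζ)).toLinearMap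
  have hΛ : LinearMap.range Λ = ⊤ := by
    by_contra hne
    obtain ⟨φ, hφ0, hφ⟩ := Submodule.exists_le_ker_of_lt_top _ (lt_top_iff_ne_top.2 hne)
    have hφ' : ∀ c f, φ (restrictTo E (harmonicFun c + toContinuousMap (green ζ f))) = 0 :=
      fun c f => hφ ⟨(c, f), rfl⟩
    let ψ : C(SG, ℝ) →L[ℝ] ℝ := (LinearMap.toContinuousLinearMap φ).comp (restrictTo E)
    have hψ : ∀ g, ψ g = φ (restrictTo E g) := fun _ => rfl
    have hψJ : ψ.comp toContinuousMap = 0 := eq_zero_of_comp_green ζ fun f => by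
      have := hφ' 0 f
      rwa [map_zero, zero_add] at this
    have hψ0 : ∀ g : C(SG, ℝ), (∀ i, g (q i) = 0) → ψ g = 0 := fun g hg => by
      refine closure_minimal (fun v hv => ?_) (isClosed_eq ψ.continuous continuous_const)
        (mem_closure_domEnergyZero hg)
      obtain ⟨w, rfl⟩ := exists_toContinuousMap_eq hv
      exact DFunLike.congr_fun hψJ w
    apply hφ0
    refine LinearMap.ext fun b => ?_
    obtain ⟨g, rfl⟩ := restrictTo_surjective E b
    have h1 := hψ0 (g - harmonicFun fun i => g (q i)) fun i => by simp [harmonic_q]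
    have h2 := hφ' (fun i => g (q i)) 0
    rw [map_zero, map_zero, add_zero, ← hψ] at h2
    rw [map_sub, h2, sub_zero] at h1
    exact h1
  obtain ⟨⟨c, f⟩, hcf⟩ := LinearMap.range_eq_top.1 hΛ a
  exact ⟨c, f, hcf⟩

end Laplacian

theorem mem_constraintSet_iff {ζ : Measure SG} {E : Finset SG} {a : E → ℝ} {u : C(SG, ℝ)} :
    u ∈ constraintSet ζ E a ↔ (∃ f, IsLaplacian ζ u f) ∧ restrictTo E u = a := by
  rw [funext_iff]
  rfl

theorem restrictTo_harmonic_injective {E : Finset SG} (hE : ∃ x : Fin 3 → SG, (∀ k, x k ∈ E) ∧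
    IsUnit (Matrix.of fun k j : Fin 3 => h j (x k))) {c : Fin 3 → ℝ}
    (hc : restrictTo E (harmonicFun c) = 0) : c = 0 := by
  obtain ⟨x, hxE, hx⟩ := hE
  refine Matrix.mulVec_injective_of_isUnit hx ?_
  rw [Matrix.mulVec_zero]
  ext k
  have := congrFun hc ⟨x k, hxE k⟩
  rw [restrictTo_apply, harmonic_apply] at this
  simpa [Matrix.mulVec, dotProduct, mul_comm] using this

end SierpinskiGasket

end

/-! ### Existence and uniqueness of the minimizer -/

open SierpinskiGasket in
theorem mainTheorem7
    (ζ : MeasureTheory.Measure SierpinskiGasket.SG)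
    [MeasureTheory.IsFiniteMeasure ζ] [ζ.IsOpenPosMeasure]
    (hζ : ∀ x : SierpinskiGasket.SG, ζ {x} = 0)
    (E : Finset SierpinskiGasket.SG)
    (hE : ∃ x : Fin 3 → SierpinskiGasket.SG, (∀ k, x k ∈ E) ∧
      IsUnit (Matrix.of fun k j : Fin 3 => SierpinskiGasket.h j (x k)))
    (a : E → ℝ) :
    ∃! u : C(SierpinskiGasket.SG, ℝ),
      u ∈ SierpinskiGasket.constraintSet ζ E a ∧
      ∀ v ∈ SierpinskiGasket.constraintSet ζ E a,
        SierpinskiGasket.T ζ u ≤ SierpinskiGasket.T ζ v := by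
  obtain ⟨c₀, f₀, h₀⟩ := exists_interpolation ζ E a
  let B : Lp ℝ 2 ζ →L[ℝ] (E → ℝ) := (restrictTo E).comp (toContinuousMap.comp (green ζ))
  let A : (Fin 3 → ℝ) →ₗ[ℝ] (E → ℝ) := (restrictTo E).toLinearMap ∘ₗ harmonicFun
  have hAB : ∀ c f, restrictTo E (harmonicFun c + toContinuousMap (green ζ f)) = A c + B f :=
    fun c f => map_add _ _ _
  -- The changes of the Laplacian whose effect on `E` a harmonic function can cancel. Subtracting
  -- from `f₀` its projection to `W` gives the admissible Laplacian of least norm.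
  let W : Submodule ℝ (Lp ℝ 2 ζ) := (LinearMap.range A).comap B.toLinearMap
  have hW : IsClosed (W : Set (Lp ℝ 2 ζ)) :=
    (LinearMap.range A).closed_of_finiteDimensional.preimage B.continuous
  have : CompleteSpace W := hW.completeSpace_coe
  let p : Lp ℝ 2 ζ := W.starProjection f₀
  have hp : p ∈ W := W.starProjection_apply_mem f₀
  -- Replacing `f₀` by `f₀ - p` lowers the values on `E` by `B p`; the harmonic function with
  -- boundary values `d` restores them.
  obtain ⟨d, hd⟩ : ∃ d, A d = B p := hp
  have horth : ∀ w ∈ W, inner ℝ (f₀ - p) w = 0 := fun w hw =>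
    W.starProjection_inner_eq_zero f₀ w hw
  have hu : IsLaplacian ζ (harmonicFun (c₀ + d) + toContinuousMap (green ζ (f₀ - p))) (f₀ - p) :=
    isLaplacian_harmonic_add_green ζ _ _
  have hua : A (c₀ + d) + B (f₀ - p) = a := by
    rw [← h₀, hAB, map_add, map_sub, hd]
    abel
  have hY : ∀ v ∈ constraintSet ζ E a, ∃ c f, v = harmonicFun c + toContinuousMap (green ζ f) ∧
      A c + B f = a ∧ T ζ v = ‖f₀ - p‖ ^ 2 + ‖f - (f₀ - p)‖ ^ 2 := by
    intro v hv
    obtain ⟨⟨f, hf⟩, hva⟩ := mem_constraintSet_iff.1 hv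
    have hv' := (isLaplacian_iff ζ).1 hf
    have hcf : A (fun i => v (q i)) + B f = a := by rw [← hAB, ← hv', hva]
    refine ⟨_, f, hv', hcf, ?_⟩
    -- Two admissible Laplacians differ by an element of `W`, to which `f₀ - p` is orthogonal;
    -- Pythagoras then gives the formula for `T`.
    have hfW : f - (f₀ - p) ∈ W := by
      refine ⟨c₀ + d - fun i => v (q i), ?_⟩
      change A _ = B _
      rw [map_sub, map_sub B, sub_eq_sub_iff_add_eq_add, hua, add_comm, hcf]
    have h1 := norm_add_sq_eq_norm_sq_add_norm_sq_of_inner_eq_zero _ _ (horth _ hfW)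
    rw [add_sub_cancel] at h1
    rw [hf.T_eq ζ hζ, sq, h1, sq, sq]
  refine ⟨_, ⟨mem_constraintSet_iff.2 ⟨⟨_, hu⟩, (hAB _ _).trans hua⟩, fun v hv => ?_⟩, ?_⟩
  · obtain ⟨c, f, -, -, hT⟩ := hY v hv
    rw [hu.T_eq ζ hζ, hT]
    exact le_add_of_nonneg_right (sq_nonneg _)
  · rintro v ⟨hv, hmin⟩
    obtain ⟨c, f, rfl, hcf, hT⟩ := hY v hv
    have h1 := hmin _ (mem_constraintSet_iff.2 ⟨⟨_, hu⟩, (hAB _ _).trans hua⟩)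
    rw [hu.T_eq ζ hζ, hT] at h1
    have h2 : ‖f - (f₀ - p)‖ ^ 2 = 0 := le_antisymm (by linarith) (sq_nonneg _)
    have h3 : f = f₀ - p := by
      rwa [sq_eq_zero_iff, norm_eq_zero, sub_eq_zero] at h2
    have h4 : A (c - (c₀ + d)) = 0 := by
      rw [map_sub, sub_eq_zero]
      rw [← hua, h3] at hcf
      exact add_right_cancel hcf
    rw [h3, sub_eq_zero.1 (restrictTo_harmonic_injective hE h4)]
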